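/- Let $f:\mathbb{R}^n\to\mathbb{R}$ be convex and continuously differentiable, let $g:\mathbb{R}^m\to\mathbb{R}\cup\{+\infty\}$ be proper, lower semicontinuous and convex, let $\operatorname{dom} g=\{z : g(z)<\infty\}$ and $\operatorname{hzn} g=\{v : g(z+v)\le g(z)\ \text{for all } z\in\operatorname{dom} g\}$, and let $c:\mathbb{R}^n\to\mathbb{R}^m$ be continuously differentiable with $$c(\lambda x+(1-\lambda)x')-\lambda c(x)-(1-\lambda)c(x')\in\operatorname{hzn} g\qquad\text{for all } x,x'\in\mathbb{R}^n,\ \lambda\in[0,1].$$ (More generally, $\mathbb{R}^n$ and $\mathbb{R}^m$ may be replaced by arbitrary finite-dimensional real Hilbert spaces.) Put $\Phi=f+g\circ c$, and assume that $c^{-1}(\operatorname{dom} g)\neq\emptyset$ and that $\Phi$ has a minimizer; let $\Phi^*$ be its minimal value. The multiplier set of $x\in\mathbb{R}^n$ is $\mathcal{Y}(x)=\{y\in\partial g(c(x)) : \nabla f(x)+c'(x)^\top y=0\}$, and $x$ is called stationary if $\mathcal{Y}(x)\ne\emptyset$. Assume that $\Phi$ has a stationary minimizer $x^\circ$, and put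 $Y_{\rm mul}=\mathcal{Y}(x^\circ)$. For $\mu>0$ let $$\mathcal{L}_\mu(x,y)=f(x)+\inf_{z}\Big\{g(z)+\langle y,c(x)-z\rangle+\tfrac1{2\mu}\|c(x)-z\|^2\Big\},$$ and let $\operatorname{prox}_{\mu g}(w)$ denote the unique minimizer of $g+\tfrac{1}{2\mu}\|\cdot-w\|^2$. Let $Y_{\rm sg}\subseteq\mathbb{R}^m$ be nonempty, convex and compact, with projection $\Pi_{Y_{\rm sg}}$, let $\beta\in(0,1)$, $\mu_0>0$, $y^0\in\mathbb{R}^m$, and let the sequences $(x^k),(z^k),(y^k),(\hat y^k)$, $(\mu_k)$, $(\varepsilon_k)$ be generated by the safeguarded augmented Lagrangian method, i.e., for all $k\ge 0$: $\hat y^k=\Pi_{Y_{\rm sg}}(y^k)$; $\varepsilon_k\ge 0$ and $x^k$ satisfies $\mathcal{L}_{\mu_k}(x^k,\hat y^k)\le\inf_x\mathcal{L}_{\mu_k}(x,\hat y^k)+\varepsilon_k$; $z^k=\operatorname{prox}_{\mu_k g}(c(x^k)+\mu_k\hat y^k)$; $y^{k+1}=\hat y^k+\mu_k^{-1}(c(x^k)-z^k)$;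 and $\mu_{k+1}=\beta_k\mu_k$ for some $\beta_k\in(0,\beta]\cup\{1\}$. Assume that $\sum_{k=0}^\infty\sqrt{\varepsilon_k/\mu_k}<\infty$, and that $\mu_k\downarrow 0$ or $Y_{\rm mul}\cap Y_{\rm sg}\neq\emptyset$ (or both). Then $c(x^k)-z^k\to 0$ and $\limsup_{k\to\infty}\,(f(x^k)+g(z^k))\le\Phi^*$. Moreover, every accumulation point of $(x^k)$ is a minimizer of $\Phi$, and for every $\bar x\in\mathbb{R}^n$ and every subsequence $(x^k)_{k\in K}$ converging to $\bar x$, the corresponding subsequences satisfy $z^k\to_K c(\bar x)$ and $f(x^k)+g(z^k)\to_K\Phi^*$. -/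

import Mathlib

open Filter Topology

noncomputable section

namespace CompositeALM

variable {E F : Type*} [NormedAddCommGroup E] [InnerProductSpace ℝ E]
  [NormedAddCommGroup F] [InnerProductSpace ℝ F]

/-- The domain `{z | φ z < ∞}` of an extended-real-valued function. -/
def dom (φ : F → EReal) : Set F := {z | φ z < ⊤}

/-- `φ` is proper: its domain is nonempty and `φ` never takes the value `-∞`. -/
def IsProper (φ : F → EReal) : Prop := (dom φ).Nonempty ∧ ∀ z, φ z ≠ ⊥

/-- The epigraph of `φ`, a subset of `F × ℝ`. -/
def epi (φ : F → EReal) : Set (F × ℝ) := {p | φ p.1 ≤ (p.2 : EReal)}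

/-- Convexity of an extended-real-valued function: its epigraph is convex. -/
def IsConvex (φ : F → EReal) : Prop := Convex ℝ (epi φ)

/-- The subdifferential of `φ` at `zbar` (empty if `zbar` is not in the domain). -/
def subdiff (φ : F → EReal) (zbar : F) : Set F :=
  {y | zbar ∈ dom φ ∧ ∀ z ∈ dom φ, φ zbar + ((inner ℝ y (z - zbar) : ℝ) : EReal) ≤ φ z}

/-- The horizon of `φ`. -/
def hzn (φ : F → EReal) : Set F := {v | ∀ z ∈ dom φ, φ (z + v) ≤ φ z}

/-- `p` is the proximal point of `w` for `γ φ`, that is, `p` minimizes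
`φ + ‖· - w‖² / (2 γ)`. For `γ > 0` and `φ` proper, lsc and convex there is exactly one such
point, namely `prox_{γ φ} w`. -/
def IsProx (γ : ℝ) (φ : F → EReal) (w p : F) : Prop :=
  IsMinOn (fun u => φ u + ((1 / (2 * γ) * ‖u - w‖ ^ 2 : ℝ) : EReal)) Set.univ p

/-- `p` is the projection of `y` onto `C`, that is, a point of `C` of least distance to `y`
(exactly one such point exists if `C` is nonempty, closed and convex). -/
def IsProj (C : Set F) (y p : F) : Prop := p ∈ C ∧ ‖p - y‖ = Metric.infDist y C

/-- The objective `Φ = f + g ∘ c`. -/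
def objective (f : E → ℝ) (g : F → EReal) (c : E → F) (x : E) : EReal :=
  (f x : EReal) + g (c x)

/-- The minimal (infimal) value `Φ*`. -/
def optVal (f : E → ℝ) (g : F → EReal) (c : E → F) : EReal := ⨅ x, objective f g c x

/-- `x` is a (global) minimizer of `Φ = f + g ∘ c`. -/
def IsMinimizer (f : E → ℝ) (g : F → EReal) (c : E → F) (x : E) : Prop :=
  IsMinOn (objective f g c) Set.univ x

/-- The augmented Lagrangian
`L_μ(x, y) = f(x) + inf_z { g(z) + ⟨y, c(x) - z⟩ + ‖c(x) - z‖² / (2 μ) }`. -/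
def augLagrangian (f : E → ℝ) (g : F → EReal) (c : E → F) (μ : ℝ) (x : E) (y : F) : EReal :=
  (f x : EReal) +
    ⨅ z, (g z + ((inner ℝ y (c x - z) + 1 / (2 * μ) * ‖c x - z‖ ^ 2 : ℝ) : EReal))

/-- The set of multipliers associated with `x`: all `y ∈ ∂g(c(x))` with `∇ₓ L(x, y) = 0`, where
`L(·, y) = f + ⟨y, c(·)⟩ - g*(y)` is the Lagrangian. For `y ∈ ∂g(c(x))` the conjugate value
`g*(y)` is a real constant, so that it does not contribute to the derivative in `x`. -/
def multipliers (f : E → ℝ) (g : F → EReal) (c : E → F) (x : E) : Set F :=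
  {y | y ∈ subdiff g (c x) ∧
    HasFDerivAt (fun x' => f x' + inner ℝ y (c x')) (0 : E →L[ℝ] ℝ) x}

/-- `x` is stationary: it possesses a multiplier. -/
def IsStationary (f : E → ℝ) (g : F → EReal) (c : E → F) (x : E) : Prop :=
  (multipliers f g c x).Nonempty

/-- The standing assumptions on the fully convex composite problem
`minimize f(x) + g(c(x))`. -/
structure FullyConvexComposite (f : E → ℝ) (g : F → EReal) (c : E → F) : Prop where
  contDiff_f : ContDiff ℝ 1 f
  convex_f : ConvexOn ℝ Set.univ f
  proper_g : IsProper g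
  lsc_g : LowerSemicontinuous g
  convex_g : IsConvex g
  contDiff_c : ContDiff ℝ 1 c
  /-- `c` is `(-hzn g)`-convex -/
  convex_c : ∀ x x' : E, ∀ t : ℝ, 0 ≤ t → t ≤ 1 →
    c (t • x + (1 - t) • x') - t • c x - (1 - t) • c x' ∈ hzn g
  feasible : ∃ x, c x ∈ dom g
  exists_minimizer : ∃ x, IsMinimizer f g c x

/-- The sequences `x, z, y, yhat`, with penalty parameters `μ` and inexactness parameters `ε`, are
generated by the safeguarded augmented Lagrangian method with safeguarding set `Ysg` and
parameter `β`, started at an arbitrary `y 0` and `μ 0 > 0`. -/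
structure IsSafeguardedALM (f : E → ℝ) (g : F → EReal) (c : E → F) (Ysg : Set F) (β : ℝ)
    (μ ε : ℕ → ℝ) (x : ℕ → E) (z y yhat : ℕ → F) : Prop where
  Ysg_nonempty : Ysg.Nonempty
  Ysg_convex : Convex ℝ Ysg
  Ysg_compact : IsCompact Ysg
  β_pos : 0 < β
  β_lt_one : β < 1
  μ_zero_pos : 0 < μ 0
  /-- `yhat k` is the projection of `y k` onto `Ysg` -/
  yhat_eq : ∀ k, IsProj Ysg (y k) (yhat k)
  ε_nonneg : ∀ k, 0 ≤ ε k
  /-- `x k` minimizes the augmented Lagrangian up to `ε k` -/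
  x_subproblem : ∀ k, augLagrangian f g c (μ k) (x k) (yhat k) ≤
    (⨅ x', augLagrangian f g c (μ k) x' (yhat k)) + (ε k : EReal)
  z_eq : ∀ k, IsProx (μ k) g (c (x k) + μ k • yhat k) (z k)
  y_succ : ∀ k, y (k + 1) = yhat k + (μ k)⁻¹ • (c (x k) - z k)
  μ_succ : ∀ k, ∃ b : ℝ, (0 < b ∧ b ≤ β ∨ b = 1) ∧ μ (k + 1) = b * μ k

end CompositeALM

end

set_option linter.unusedSectionVars false

namespace CompositeALM

section

variable {E F : Type*} [NormedAddCommGroup E] [InnerProductSpace ℝ E]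
  [NormedAddCommGroup F] [InnerProductSpace ℝ F]

lemma IsProper.coe_toReal {g : F → EReal} (hg : IsProper g) {z : F} (hz : z ∈ dom g) :
    ((g z).toReal : EReal) = g z :=
  EReal.coe_toReal (ne_of_lt hz) (hg.2 z)

lemma mem_dom_of_le_coe {g : F → EReal} {z : F} {a : ℝ} (h : g z ≤ (a : EReal)) : z ∈ dom g :=
  lt_of_le_of_lt h (EReal.coe_lt_top a)

lemma IsProper.toReal_le {g : F → EReal} (hg : IsProper g) {z : F} {a : ℝ}
    (h : g z ≤ (a : EReal)) : (g z).toReal ≤ a := by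
  rw [← hg.coe_toReal (mem_dom_of_le_coe h)] at h
  exact_mod_cast h

/-- Midpoint convexity of `g` on its domain. -/
lemma IsConvex.midpoint_le {g : F → EReal} (hc : IsConvex g) (hg : IsProper g) {a b : F}
    (ha : a ∈ dom g) (hb : b ∈ dom g) :
    g ((1 / 2 : ℝ) • a + (1 / 2 : ℝ) • b) ≤
      ((1 / 2 * (g a).toReal + 1 / 2 * (g b).toReal : ℝ) : EReal) := by
  have h1 : (a, (g a).toReal) ∈ epi g := (hg.coe_toReal ha).ge
  have h2 : (b, (g b).toReal) ∈ epi g := (hg.coe_toReal hb).ge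
  exact hc h1 h2 (by norm_num : (0 : ℝ) ≤ 1 / 2) (by norm_num : (0 : ℝ) ≤ 1 / 2) (by norm_num)

lemma le_toReal_of_mem_subdiff {g : F → EReal} (hg : IsProper g) {zbar y : F}
    (hy : y ∈ subdiff g zbar) {z : F} (hz : z ∈ dom g) :
    (g zbar).toReal + inner ℝ y (z - zbar) ≤ (g z).toReal := by
  have h := hy.2 z hz
  rw [← hg.coe_toReal hy.1, ← hg.coe_toReal hz] at h
  exact_mod_cast h

/-- Subgradients belong to the polar cone of the horizon. -/
lemma inner_nonpos_of_mem_hzn {g : F → EReal} (hg : IsProper g) {zbar y v : F}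
    (hy : y ∈ subdiff g zbar) (hv : v ∈ hzn g) : inner ℝ y v ≤ 0 := by
  have h1 : g (zbar + v) ≤ ((g zbar).toReal : EReal) := by
    rw [hg.coe_toReal hy.1]; exact hv zbar hy.1
  have h2 := le_toReal_of_mem_subdiff hg hy (mem_dom_of_le_coe h1)
  have h3 := hg.toReal_le h1
  rw [add_sub_cancel_left] at h2
  linarith

/-- A convex function attains its minimum where its derivative vanishes. -/
lemma _root_.ConvexOn.le_of_hasFDerivAt_zero {h : E → ℝ} (hh : ConvexOn ℝ Set.univ h) {x₀ : E}
    (hd : HasFDerivAt h (0 : E →L[ℝ] ℝ) x₀) (x : E) : h x₀ ≤ h x := by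
  have hconv : ConvexOn ℝ Set.univ (h ∘ (AffineMap.lineMap x₀ x : ℝ →ᵃ[ℝ] E)) := by
    simpa using hh.comp_affineMap (AffineMap.lineMap (k := ℝ) x₀ x)
  have hderiv : HasDerivAt (h ∘ (AffineMap.lineMap x₀ x : ℝ →ᵃ[ℝ] E)) 0 (0 : ℝ) := by
    have h1 : HasDerivAt (AffineMap.lineMap x₀ x : ℝ →ᵃ[ℝ] E) (x - x₀) 0 :=
      AffineMap.hasDerivAt_lineMap
    have h2 : HasFDerivAt h (0 : E →L[ℝ] ℝ) ((AffineMap.lineMap x₀ x : ℝ →ᵃ[ℝ] E) 0) := by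
      simpa using hd
    simpa using h2.comp_hasDerivAt (0 : ℝ) h1
  have := hconv.le_slope_of_hasDerivAt (Set.mem_univ (0 : ℝ)) (Set.mem_univ (1 : ℝ))
    one_pos hderiv
  simpa [slope_def_field] using this

lemma FullyConvexComposite.convexOn_lagrangian {f : E → ℝ} {g : F → EReal} {c : E → F}
    (hP : FullyConvexComposite f g c) {zbar y : F} (hy : y ∈ subdiff g zbar) :
    ConvexOn ℝ Set.univ (fun x => f x + inner ℝ y (c x)) := by
  refine hP.convex_f.add ⟨convex_univ, fun x _ x' _ a b ha hb hab => ?_⟩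
  obtain rfl : b = 1 - a := by linarith
  have := inner_nonpos_of_mem_hzn hP.proper_g hy (hP.convex_c x x' a ha (by linarith))
  simp only [inner_sub_right, inner_smul_right] at this
  simp only [smul_eq_mul]
  linarith

lemma FullyConvexComposite.lagrangian_le {f : E → ℝ} {g : F → EReal} {c : E → F}
    (hP : FullyConvexComposite f g c) {xs : E} {y : F} (hy : y ∈ multipliers f g c xs)
    (x : E) {z : F} (hz : z ∈ dom g) :
    f xs + (g (c xs)).toReal - inner ℝ y (c x - z) ≤ f x + (g z).toReal := by
  have h1 := (hP.convexOn_lagrangian hy.1).le_of_hasFDerivAt_zero hy.2 x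
  have h2 := le_toReal_of_mem_subdiff hP.proper_g hy.1 hz
  simp only [inner_sub_right] at h2 ⊢
  linarith

lemma IsProx.mem_dom {g : F → EReal} (hg : IsProper g) {γ : ℝ} {w p : F}
    (h : IsProx γ g w p) : p ∈ dom g := by
  obtain ⟨z, hz⟩ := hg.1
  have h1 := isMinOn_univ_iff.1 h z
  by_contra hp
  have hp' : g p = ⊤ := not_lt_top_iff.1 hp
  simp only [hp', EReal.top_add_coe, top_le_iff] at h1
  rw [← hg.coe_toReal hz, ← EReal.coe_add] at h1
  exact EReal.coe_ne_top _ h1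

lemma norm_sub_add_smul_sq (μ : ℝ) (hμ : 0 < μ) (a y z : F) :
    inner ℝ y (a - z) + 1 / (2 * μ) * ‖a - z‖ ^ 2 =
      1 / (2 * μ) * ‖z - (a + μ • y)‖ ^ 2 + -(μ / 2 * ‖y‖ ^ 2) := by
  have : z - (a + μ • y) = -((a - z) + μ • y) := by abel
  rw [this, norm_neg, norm_add_sq_real, norm_smul, inner_smul_right, Real.norm_eq_abs,
    mul_pow, sq_abs, real_inner_comm]
  field_simp
  ring

/-- A proximal point attains the infimum which defines the augmented Lagrangian. -/
lemma le_augLagrangian {f : E → ℝ} {g : F → EReal} {c : E → F} (hg : IsProper g) {μ : ℝ}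
    (hμ : 0 < μ) {x : E} {y z : F} (hz : IsProx μ g (c x + μ • y) z) :
    ((f x + ((g z).toReal + (inner ℝ y (c x - z) + 1 / (2 * μ) * ‖c x - z‖ ^ 2)) : ℝ) : EReal) ≤
      augLagrangian f g c μ x y := by
  rw [EReal.coe_add, EReal.coe_add, hg.coe_toReal (hz.mem_dom hg)]
  refine add_le_add le_rfl (le_iInf fun u => ?_)
  rw [norm_sub_add_smul_sq μ hμ, norm_sub_add_smul_sq μ hμ, EReal.coe_add, EReal.coe_add,
    ← add_assoc, ← add_assoc]
  exact add_le_add (isMinOn_univ_iff.1 hz u) le_rfl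

lemma augLagrangian_le {f : E → ℝ} {g : F → EReal} {c : E → F} (hg : IsProper g) {μ : ℝ}
    (x : E) (y : F) {z : F} (hz : z ∈ dom g) :
    augLagrangian f g c μ x y ≤
      ((f x + ((g z).toReal + (inner ℝ y (c x - z) + 1 / (2 * μ) * ‖c x - z‖ ^ 2)) : ℝ) :
        EReal) := by
  rw [EReal.coe_add, EReal.coe_add, hg.coe_toReal hz]
  exact add_le_add le_rfl (iInf_le _ z)

/-- Projections onto convex sets do not increase the distance to points of the set. -/
lemma IsProj.norm_sub_le {C : Set F} (hC : Convex ℝ C) {y p q : F} (hp : IsProj C y p)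
    (hq : q ∈ C) : ‖p - q‖ ^ 2 ≤ ‖y - q‖ ^ 2 := by
  have h1 : ‖y - p‖ = ⨅ w : C, ‖y - w‖ := by
    rw [norm_sub_rev, hp.2, Metric.infDist_eq_iInf]
    simp only [dist_eq_norm]
  have h2 := (norm_eq_iInf_iff_real_inner_le_zero hC hp.1).1 h1 q hq
  have h3 : y - q = (y - p) - (q - p) := by abel
  rw [h3, norm_sub_sq_real (y - p), norm_sub_rev p q]
  nlinarith [sq_nonneg ‖y - p‖]

namespace IsSafeguardedALM

variable {f : E → ℝ} {g : F → EReal} {c : E → F} {Ysg : Set F} {β : ℝ} {μ ε : ℕ → ℝ}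
  {x : ℕ → E} {z y yhat : ℕ → F}

lemma mu_pos (h : IsSafeguardedALM f g c Ysg β μ ε x z y yhat) (k : ℕ) : 0 < μ k := by
  induction k with
  | zero => exact h.μ_zero_pos
  | succ k ih =>
    obtain ⟨b, hb, hk⟩ := h.μ_succ k
    rw [hk]
    refine mul_pos ?_ ih
    rcases hb with hb | rfl
    exacts [hb.1, one_pos]

lemma mu_le_zero (h : IsSafeguardedALM f g c Ysg β μ ε x z y yhat) (k : ℕ) : μ k ≤ μ 0 := by
  induction k with
  | zero => exact le_rfl
  | succ k ih =>
    obtain ⟨b, hb, hk⟩ := h.μ_succ k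
    refine le_trans ?_ ih
    rw [hk]
    refine mul_le_of_le_one_left (h.mu_pos k).le ?_
    rcases hb with hb | rfl
    exacts [hb.2.trans h.β_lt_one.le, le_rfl]

lemma mem_dom (h : IsSafeguardedALM f g c Ysg β μ ε x z y yhat) (hg : IsProper g) (k : ℕ) :
    z k ∈ dom g := (h.z_eq k).mem_dom hg

lemma value_le (h : IsSafeguardedALM f g c Ysg β μ ε x z y yhat) (hg : IsProper g) (k : ℕ)
    (x' : E) {z' : F} (hz' : z' ∈ dom g) :
    f (x k) + ((g (z k)).toReal + (inner ℝ (yhat k) (c (x k) - z k) +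
        1 / (2 * μ k) * ‖c (x k) - z k‖ ^ 2)) ≤
      f x' + ((g z').toReal + (inner ℝ (yhat k) (c x' - z') +
        1 / (2 * μ k) * ‖c x' - z'‖ ^ 2)) + ε k := by
  have h1 := (le_augLagrangian (f := f) hg (h.mu_pos k) (h.z_eq k)).trans (h.x_subproblem k)
  have h2 := h1.trans (add_le_add ((iInf_le _ x').trans (augLagrangian_le hg x' (yhat k) hz'))
    le_rfl)
  exact_mod_cast h2

/-- Comparing the iterate with its midpoint with a feasible point yields quadratic growth of the
augmented Lagrangian subproblem. -/
lemma value_add_le (h : IsSafeguardedALM f g c Ysg β μ ε x z y yhat)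
    (hP : FullyConvexComposite f g c) {xs : E} (hxs : c xs ∈ dom g) (k : ℕ) :
    f (x k) + (g (z k)).toReal + inner ℝ (yhat k) (c (x k) - z k) +
        3 / 4 * (‖c (x k) - z k‖ ^ 2 / μ k) ≤
      f xs + (g (c xs)).toReal + 2 * ε k := by
  have hg := hP.proper_g
  have hz := h.mem_dom hg k
  have hμ := h.mu_pos k
  have hmid := hP.convex_g.midpoint_le hg hz hxs
  have hv := hP.convex_c (x k) xs (1 / 2) (by norm_num) (by norm_num)
  rw [show (1 - 1 / 2 : ℝ) = 1 / 2 by norm_num] at hv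
  have hle := (hv _ (mem_dom_of_le_coe hmid)).trans hmid
  have hf := hP.convex_f.2 (Set.mem_univ (x k)) (Set.mem_univ xs)
    (by norm_num : (0 : ℝ) ≤ 1 / 2) (by norm_num : (0 : ℝ) ≤ 1 / 2) (by norm_num)
  have hval := h.value_le hg k ((1 / 2 : ℝ) • x k + (1 / 2 : ℝ) • xs) (mem_dom_of_le_coe hle)
  have hG := hg.toReal_le hle
  have hr : c ((1 / 2 : ℝ) • x k + (1 / 2 : ℝ) • xs) -
      ((1 / 2 : ℝ) • z k + (1 / 2 : ℝ) • c xs +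
        (c ((1 / 2 : ℝ) • x k + (1 / 2 : ℝ) • xs) - (1 / 2 : ℝ) • c (x k) -
          (1 / 2 : ℝ) • c xs)) = (1 / 2 : ℝ) • (c (x k) - z k) := by
    rw [smul_sub]; abel
  rw [hr, inner_smul_right, norm_smul, mul_pow, Real.norm_eq_abs, sq_abs] at hval
  have hq : 1 / (2 * μ k) * ‖c (x k) - z k‖ ^ 2 = 1 / 2 * (‖c (x k) - z k‖ ^ 2 / μ k) := by
    field_simp
  have hq' : 1 / (2 * μ k) * ((1 / 2) ^ 2 * ‖c (x k) - z k‖ ^ 2) =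
      1 / 8 * (‖c (x k) - z k‖ ^ 2 / μ k) := by
    field_simp; ring
  rw [hq, hq'] at hval
  simp only [smul_eq_mul] at hf
  linarith

lemma inner_add_le (h : IsSafeguardedALM f g c Ysg β μ ε x z y yhat)
    (hP : FullyConvexComposite f g c) {xs : E} {ys : F} (hys : ys ∈ multipliers f g c xs)
    (k : ℕ) :
    inner ℝ (yhat k - ys) (c (x k) - z k) + 3 / 4 * (‖c (x k) - z k‖ ^ 2 / μ k) ≤ 2 * ε k := by
  have h1 := h.value_add_le hP hys.1.1 k
  have h2 := hP.lagrangian_le hys (x k) (h.mem_dom hP.proper_g k)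
  rw [inner_sub_left]
  linarith

/-- Fejér-type estimate for the distance of the dual iterates to a multiplier. -/
lemma norm_succ_sub_sq_le (h : IsSafeguardedALM f g c Ysg β μ ε x z y yhat)
    (hP : FullyConvexComposite f g c) {xs : E} {ys : F} (hys : ys ∈ multipliers f g c xs)
    (hsg : ys ∈ Ysg) (k : ℕ) :
    ‖yhat (k + 1) - ys‖ ^ 2 + 1 / 2 * ‖(μ k)⁻¹ • (c (x k) - z k)‖ ^ 2 ≤
      ‖yhat k - ys‖ ^ 2 + 4 * (ε k / μ k) := by
  have hμ := h.mu_pos k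
  have h1 := (h.yhat_eq (k + 1)).norm_sub_le h.Ysg_convex hsg
  have h2 := h.inner_add_le hP hys k
  have h3 : y (k + 1) - ys = (yhat k - ys) + (μ k)⁻¹ • (c (x k) - z k) := by
    rw [h.y_succ k]; abel
  rw [h3, norm_add_sq_real, inner_smul_right] at h1
  have h4 : ‖(μ k)⁻¹ • (c (x k) - z k)‖ ^ 2 = (μ k)⁻¹ * (‖c (x k) - z k‖ ^ 2 / μ k) := by
    rw [norm_smul, mul_pow, Real.norm_eq_abs, sq_abs]
    field_simp
  have h5 := mul_le_mul_of_nonneg_left h2 (inv_pos.2 hμ).le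
  rw [mul_add] at h5
  have h6 : (μ k)⁻¹ * (2 * ε k) = 2 * (ε k / μ k) := by field_simp
  linarith

lemma summable_eps_div (h : IsSafeguardedALM f g c Ysg β μ ε x z y yhat)
    (hsum : Summable fun k => √(ε k / μ k)) : Summable fun k => ε k / μ k := by
  have h0 : ∀ k, 0 ≤ ε k / μ k := fun k => div_nonneg (h.ε_nonneg k) (h.mu_pos k).le
  refine Summable.of_norm_bounded_eventually_nat hsum ?_
  filter_upwards [hsum.tendsto_atTop_zero.eventually (gt_mem_nhds one_pos)] with k hk
  rw [Real.norm_of_nonneg (h0 k)]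
  nlinarith [Real.sq_sqrt (h0 k), Real.sqrt_nonneg (ε k / μ k)]

lemma tendsto_eps (h : IsSafeguardedALM f g c Ysg β μ ε x z y yhat)
    (hsum : Summable fun k => √(ε k / μ k)) : Tendsto ε atTop (𝓝 0) := by
  refine squeeze_zero h.ε_nonneg (fun k => ?_)
    (by simpa using (h.summable_eps_div hsum).tendsto_atTop_zero.const_mul (μ 0))
  have hμ := h.mu_pos k
  calc ε k = μ k * (ε k / μ k) := by field_simp
    _ ≤ μ 0 * (ε k / μ k) :=
      mul_le_mul_of_nonneg_right (h.mu_le_zero k) (div_nonneg (h.ε_nonneg k) hμ.le)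

lemma exists_norm_yhat_sub_le (h : IsSafeguardedALM f g c Ysg β μ ε x z y yhat) (ys : F) :
    ∃ M, ∀ k, ‖yhat k - ys‖ ≤ M := by
  obtain ⟨M, hM⟩ := h.Ysg_compact.isBounded.subset_closedBall ys
  exact ⟨M, fun k => by simpa [dist_eq_norm] using hM (h.yhat_eq k).1⟩

lemma tendsto_residual_of_tendsto_mu (h : IsSafeguardedALM f g c Ysg β μ ε x z y yhat)
    (hP : FullyConvexComposite f g c) {xs : E} {ys : F} (hys : ys ∈ multipliers f g c xs)
    (hε : Tendsto ε atTop (𝓝 0)) (hμ : Tendsto μ atTop (𝓝 0)) :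
    Tendsto (fun k => c (x k) - z k) atTop (𝓝 0) := by
  obtain ⟨M, hM⟩ := h.exists_norm_yhat_sub_le ys
  have hsq : Tendsto (fun k => ‖c (x k) - z k‖ ^ 2) atTop (𝓝 0) := by
    refine squeeze_zero (g := fun k => 4 * (μ k * ε k) + 2 * (μ k * μ k * M ^ 2))
      (fun k => sq_nonneg _) (fun k => ?_) ?_
    · have hk := h.mu_pos k
      have h1 := h.inner_add_le hP hys k
      have h2 := (abs_le.1 (abs_real_inner_le_norm (yhat k - ys) (c (x k) - z k))).1
      have h3 := mul_le_mul_of_nonneg_right (hM k) (norm_nonneg (c (x k) - z k))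
      have h4 : 3 / 4 * ‖c (x k) - z k‖ ^ 2 ≤ μ k * (2 * ε k + M * ‖c (x k) - z k‖) := by
        calc 3 / 4 * ‖c (x k) - z k‖ ^ 2
            = μ k * (3 / 4 * (‖c (x k) - z k‖ ^ 2 / μ k)) := by field_simp
          _ ≤ _ := mul_le_mul_of_nonneg_left (by linarith) hk.le
      nlinarith [sq_nonneg (‖c (x k) - z k‖ - 2 * (μ k * M))]
    · simpa using ((hμ.mul hε).const_mul 4).add (((hμ.mul hμ).mul_const (M ^ 2)).const_mul 2)
  rw [tendsto_zero_iff_norm_tendsto_zero]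
  simpa [Real.sqrt_sq] using hsq.sqrt

lemma tendsto_residual_of_mem (h : IsSafeguardedALM f g c Ysg β μ ε x z y yhat)
    (hP : FullyConvexComposite f g c) {xs : E} {ys : F} (hys : ys ∈ multipliers f g c xs)
    (hsg : ys ∈ Ysg) (hsum : Summable fun k => ε k / μ k) :
    Tendsto (fun k => c (x k) - z k) atTop (𝓝 0) := by
  have h0 : ∀ k, 0 ≤ ε k / μ k := fun k => div_nonneg (h.ε_nonneg k) (h.mu_pos k).le
  have hpartial : ∀ n, ‖yhat n - ys‖ ^ 2 +
      ∑ k ∈ Finset.range n, 1 / 2 * ‖(μ k)⁻¹ • (c (x k) - z k)‖ ^ 2 ≤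
      ‖yhat 0 - ys‖ ^ 2 + ∑ k ∈ Finset.range n, 4 * (ε k / μ k) := by
    intro n
    induction n with
    | zero => simp
    | succ n ih =>
      rw [Finset.sum_range_succ, Finset.sum_range_succ]
      linarith [h.norm_succ_sub_sq_le hP hys hsg n]
  have hs : Summable fun k => 1 / 2 * ‖(μ k)⁻¹ • (c (x k) - z k)‖ ^ 2 := by
    refine summable_of_sum_range_le (c := ‖yhat 0 - ys‖ ^ 2 + ∑' k, 4 * (ε k / μ k))
      (fun k => by positivity) (fun n => ?_)
    have := (hsum.mul_left 4).sum_le_tsum (Finset.range n)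
      (fun k _ => mul_nonneg (by norm_num) (h0 k))
    linarith [hpartial n, sq_nonneg ‖yhat n - ys‖]
  have hnorm : Tendsto (fun k => ‖(μ k)⁻¹ • (c (x k) - z k)‖) atTop (𝓝 0) := by
    have := (hs.tendsto_atTop_zero.const_mul 2).sqrt
    simpa [← mul_assoc, Real.sqrt_sq] using this
  refine squeeze_zero_norm (fun k => ?_) (by simpa using hnorm.const_mul (μ 0))
  have hk := h.mu_pos k
  calc ‖c (x k) - z k‖ = ‖μ k • (μ k)⁻¹ • (c (x k) - z k)‖ := by rw [smul_inv_smul₀ hk.ne']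
    _ = μ k * ‖(μ k)⁻¹ • (c (x k) - z k)‖ := by rw [norm_smul, Real.norm_of_nonneg hk.le]
    _ ≤ _ := mul_le_mul_of_nonneg_right (h.mu_le_zero k) (norm_nonneg _)

lemma tendsto_value (h : IsSafeguardedALM f g c Ysg β μ ε x z y yhat)
    (hP : FullyConvexComposite f g c) {xs : E} {ys : F} (hys : ys ∈ multipliers f g c xs)
    (hε : Tendsto ε atTop (𝓝 0)) (hr : Tendsto (fun k => c (x k) - z k) atTop (𝓝 0)) :
    Tendsto (fun k => f (x k) + (g (z k)).toReal) atTop (𝓝 (f xs + (g (c xs)).toReal)) := by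
  obtain ⟨M, hM⟩ := h.exists_norm_yhat_sub_le 0
  have hn := tendsto_zero_iff_norm_tendsto_zero.1 hr
  refine tendsto_of_tendsto_of_tendsto_of_le_of_le
    (g := fun k => f xs + (g (c xs)).toReal - inner ℝ ys (c (x k) - z k))
    (h := fun k => f xs + (g (c xs)).toReal + 2 * ε k + M * ‖c (x k) - z k‖)
    ?_ ?_ (fun k => hP.lagrangian_le hys (x k) (h.mem_dom hP.proper_g k)) (fun k => ?_)
  · simpa using (tendsto_const_nhds (x := f xs + (g (c xs)).toReal)).sub
      ((tendsto_const_nhds (x := ys)).inner hr)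
  · simpa using ((tendsto_const_nhds (x := f xs + (g (c xs)).toReal)).add
      (hε.const_mul 2)).add (hn.const_mul M)
  · have h1 := h.value_add_le hP hys.1.1 k
    have h2 := (abs_le.1 (abs_real_inner_le_norm (yhat k) (c (x k) - z k))).1
    have h3 := mul_le_mul_of_nonneg_right (hM k) (norm_nonneg (c (x k) - z k))
    have h4 : 0 ≤ ‖c (x k) - z k‖ ^ 2 / μ k := div_nonneg (sq_nonneg _) (h.mu_pos k).le
    rw [sub_zero] at h3
    change f (x k) + (g (z k)).toReal ≤ _
    linarith

end IsSafeguardedALM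

lemma IsMinimizer.optVal_eq {f : E → ℝ} {g : F → EReal} {c : E → F} {x : E}
    (h : IsMinimizer f g c x) : optVal f g c = objective f g c x :=
  le_antisymm (iInf_le _ x) (le_iInf (isMinOn_univ_iff.1 h))

lemma isMinimizer_of_objective_le {f : E → ℝ} {g : F → EReal} {c : E → F} {x : E}
    (h : objective f g c x ≤ optVal f g c) : IsMinimizer f g c x :=
  isMinOn_univ_iff.2 fun x' => h.trans (iInf_le _ x')

/-- Lower semicontinuity of `g` along a sequence on which `f + g` converges. -/
lemma objective_le_of_tendsto {f : E → ℝ} {g : F → EReal} {c : E → F} (hf : Continuous f)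
    (hg : IsProper g) (hlsc : LowerSemicontinuous g) {x : ℕ → E} {z : ℕ → F} {xbar : E} {a : ℝ}
    (hzdom : ∀ j, z j ∈ dom g) (hx : Tendsto x atTop (𝓝 xbar))
    (hz : Tendsto z atTop (𝓝 (c xbar)))
    (hv : Tendsto (fun j => f (x j) + (g (z j)).toReal) atTop (𝓝 a)) :
    objective f g c xbar ≤ (a : EReal) := by
  have hlim : Tendsto (fun j => g (z j)) atTop (𝓝 ((a - f xbar : ℝ) : EReal)) := by
    have h1 := hv.sub ((hf.tendsto xbar).comp hx)
    refine ((continuous_coe_real_ereal.tendsto _).comp h1).congr fun j => ?_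
    simp [hg.coe_toReal (hzdom j)]
  have hle : g (c xbar) ≤ ((a - f xbar : ℝ) : EReal) := by
    refine le_of_forall_lt fun b hb => ?_
    obtain ⟨b', hbb', hb'⟩ := exists_between hb
    exact hbb'.trans_le (ge_of_tendsto hlim
      ((hz.eventually (hlsc (c xbar) b' hb')).mono fun _ h => h.le))
  calc objective f g c xbar ≤ (f xbar : EReal) + ((a - f xbar : ℝ) : EReal) :=
        add_le_add le_rfl hle
    _ = (a : EReal) := by rw [← EReal.coe_add]; congr 1; ring

end

end CompositeALM

theorem corollary5p5 {E F : Type*}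
    [NormedAddCommGroup E] [InnerProductSpace ℝ E] [FiniteDimensional ℝ E]
    [NormedAddCommGroup F] [InnerProductSpace ℝ F] [FiniteDimensional ℝ F]
    (f : E → ℝ) (g : F → EReal) (c : E → F)
    (hP : CompositeALM.FullyConvexComposite f g c)
    -- a stationary minimizer, whose multiplier set is `Y_mul`
    (xs : E) (hxs_min : CompositeALM.IsMinimizer f g c xs)
    (hxs_stat : CompositeALM.IsStationary f g c xs)
    (Ysg : Set F) (β : ℝ) (μ ε : ℕ → ℝ) (x : ℕ → E) (z y yhat : ℕ → F)
    (hALM : CompositeALM.IsSafeguardedALM f g c Ysg β μ ε x z y yhat)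
    (hsum : Summable (fun k => Real.sqrt (ε k / μ k)))
    (hcase : Tendsto μ atTop (𝓝[>] 0) ∨
      (CompositeALM.multipliers f g c xs ∩ Ysg).Nonempty) :
    Tendsto (fun k => c (x k) - z k) atTop (𝓝 0) ∧
    limsup (fun k => (f (x k) : EReal) + g (z k)) atTop ≤ CompositeALM.optVal f g c ∧
    (∀ xbar : E, MapClusterPt xbar atTop x → CompositeALM.IsMinimizer f g c xbar) ∧
    (∀ (xbar : E) (φ : ℕ → ℕ), StrictMono φ →
      Tendsto (fun j => x (φ j)) atTop (𝓝 xbar) →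
        Tendsto (fun j => z (φ j)) atTop (𝓝 (c xbar)) ∧
        Tendsto (fun j => (f (x (φ j)) : EReal) + g (z (φ j))) atTop
          (𝓝 (CompositeALM.optVal f g c))) := by
  obtain ⟨ys, hys⟩ := hxs_stat
  have hg := hP.proper_g
  have hdom := hALM.mem_dom hg
  have hε := hALM.tendsto_eps hsum
  have hr : Tendsto (fun k => c (x k) - z k) atTop (𝓝 0) := by
    rcases hcase with hμ | ⟨ys', hys', hsg⟩
    · exact hALM.tendsto_residual_of_tendsto_mu hP hys hε (tendsto_nhdsWithin_iff.1 hμ).1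
    · exact hALM.tendsto_residual_of_mem hP hys' hsg (hALM.summable_eps_div hsum)
  have hv := hALM.tendsto_value hP hys hε hr
  have hopt : CompositeALM.optVal f g c = ((f xs + (g (c xs)).toReal : ℝ) : EReal) := by
    rw [hxs_min.optVal_eq, EReal.coe_add, hg.coe_toReal hys.1.1, CompositeALM.objective]
  have hvE : Tendsto (fun k => (f (x k) : EReal) + g (z k)) atTop
      (𝓝 (CompositeALM.optVal f g c)) := by
    rw [hopt]
    refine ((continuous_coe_real_ereal.tendsto _).comp hv).congr fun k => ?_
    simp [hg.coe_toReal (hdom k)]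
  have hzlim : ∀ (xbar : E) (φ : ℕ → ℕ), StrictMono φ →
      Tendsto (fun j => x (φ j)) atTop (𝓝 xbar) →
        Tendsto (fun j => z (φ j)) atTop (𝓝 (c xbar)) := by
    intro xbar φ hφ hx
    have h1 := ((hP.contDiff_c.continuous.tendsto xbar).comp hx).sub
      (hr.comp hφ.tendsto_atTop)
    simpa [Function.comp_def] using h1
  refine ⟨hr, hvE.limsup_eq.le, fun xbar hx => ?_, fun xbar φ hφ hx =>
    ⟨hzlim xbar φ hφ hx, hvE.comp hφ.tendsto_atTop⟩⟩
  obtain ⟨φ, hφ, hxφ⟩ := hx.tendsto_subseq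
  refine CompositeALM.isMinimizer_of_objective_le ?_
  rw [hopt]
  exact CompositeALM.objective_le_of_tendsto hP.contDiff_f.continuous hg hP.lsc_g
    (fun j => hdom (φ j)) hxφ (hzlim xbar φ hφ hxφ) (hv.comp hφ.tendsto_atTop)
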